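/- Let $p$ be a prime number and let $G=\mathbb Z_{p^2}\times\mathbb Z_{p^2}$. For subsets $A,B,C\subseteq G$ write $C=A\oplus B$ if every element of $C$ can be written as $a+b$ with $a\in A$, $b\in B$ in exactly one way and every such sum lies in $C$. Call $(A,B)$ a tiling pair in $G$ if $A\oplus B=G$, and call a set $A\subseteq G$ periodic if $A=H\oplus A'$ for some nontrivial subgroup $H\le G$ (i.e. $H\neq\{0\}$) and some $A'\subseteq G$. Let $(A,B)$ be a tiling pair in $G$ such that neither $A$ nor $B$ is periodic. Then either there is a periodic set $A'\subseteq G$ such that $(A',B)$ is a tiling pair in $G$, or there is a periodic set $B'\subseteq G$ such that $(A,B')$ is a tiling pair in $G$. -/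

import Mathlib

/-- `C = A ⊕ B`: addition maps `A × B` bijectively onto `C`, that is, every element of `C` is
`a + b` for exactly one pair `(a, b) ∈ A × B`, and all such sums lie in `C`. -/
def IsDirectSumOf {G : Type*} [AddCommGroup G] (A B C : Set G) : Prop :=
  Set.BijOn (fun x : G × G => x.1 + x.2) (A ×ˢ B) C

/-- `(A, B)` is a tiling pair in `G`: `A ⊕ B = G`. -/
def IsTilingPair {G : Type*} [AddCommGroup G] (A B : Set G) : Prop :=
  IsDirectSumOf A B Set.univ

/-- `A` is periodic: `A = H ⊕ A'` for some nontrivial subgroup `H` and some set `A'`. -/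
def IsPeriodicSet {G : Type*} [AddCommGroup G] (A : Set G) : Prop :=
  ∃ (H : AddSubgroup G) (A' : Set G), H ≠ ⊥ ∧ IsDirectSumOf (H : Set G) A' A

/-! Write `A(χ)` for `charSum A χ`. Tiling gives `A(χ) * B(χ) = 0` for all `χ ≠ 1`, and Galois
conjugation carries a zero at `χ` to `χ ^ j` for `j` prime to `p`. Let `N = pG`, of order `p ^ 2`;
by Fourier inversion a set annihilated by every `χ` with `χ ^ p ≠ 1` is `N`-periodic.

If `#A ≤ p`, some `A(χ)` vanishes, as otherwise `B` would be periodic. Then `A` is a transversal of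
`charKer χ` in one coset of `charKer (χ ^ p)`, so it has a periodic complement. The case `#B ≤ p` is
symmetric.

Let `#A = #B = p ^ 2`. If `A(χ) = A(χ ^ p) = 0`, then `A` is a transversal of `charKer χ`, and
similarly for `B`. Otherwise no set vanishes at both `χ` and `χ ^ p`. Nonperiodicity of `A` gives
`χ` with `χ ^ p ≠ 1` and `A(χ) ≠ 0`; then `B(χ) = 0`, so `B(χ ^ p) ≠ 0` and `A(χ ^ p) = 0`. This
last zero forces `B` to vanish at all `χ ^ j * η` with `0 < j < p`, `η ^ p = 1`
(`charSum_pow_mul_eq_zero`), so each slice of `B` along a coset of `N` is equidistributed modulo `H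
= N ⊓ charKer χ`. Exchanging roles, all nonempty slices of `A` and `B` have exactly `p` elements,
and those of `B` are transversals modulo `H`. Replacing each slice of `A` by a coset of `H`
preserves the tiling (`exists_periodic_of_slices`). -/

open Finset

/-! ### Character sums, Galois conjugation and Fourier analysis on cosets. -/

section Characters

variable {G : Type*} [AddCommGroup G]

/-- The sum of the character `χ` over the finite set `A`. -/
noncomputable def charSum (A : Finset G) (χ : AddChar G ℂ) : ℂ := ∑ a ∈ A, χ a

/-- The kernel of an additive character. -/
def charKer (χ : AddChar G ℂ) : AddSubgroup G where
  carrier := {x | χ x = 1}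
  zero_mem' := χ.map_zero_eq_one
  add_mem' {x y} hx hy := by
    simp only [Set.mem_ofPred_eq] at *
    rw [AddChar.map_add_eq_mul, hx, hy, one_mul]
  neg_mem' {x} hx := by
    simp only [Set.mem_ofPred_eq] at *
    rw [AddChar.map_neg_eq_inv, hx, inv_one]

theorem mem_charKer {χ : AddChar G ℂ} {x : G} : x ∈ charKer χ ↔ χ x = 1 := Iff.rfl

/-- The subgroup of multiples of `n`. -/
def multiples (G : Type*) [AddCommGroup G] (n : ℕ) : AddSubgroup G :=
  (nsmulAddMonoidHom (α := G) n).range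

theorem mem_multiples {n : ℕ} {x : G} : x ∈ multiples G n ↔ ∃ y : G, n • y = x := Iff.rfl

theorem geom_sum_of_pow_eq_one {n : ℕ} {z : ℂ} (hz : z ^ n = 1) :
    ∑ j ∈ range n, z ^ j = if z = 1 then (n : ℂ) else 0 := by
  split_ifs with h
  · simp [h]
  · rw [geom_sum_eq h, hz, sub_self, zero_div]

theorem sum_pow_sums_eq_card {ι : Type*} [DecidableEq ι] (S : Finset ι) (z : ι → ℂ) {n : ℕ}
    (hz : ∀ i ∈ S, z i ^ n = 1) :
    ∑ j ∈ range n, ∑ i ∈ S, z i ^ j = n * (#{i ∈ S | z i = 1} : ℂ) := by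
  rw [sum_comm, sum_congr rfl fun i hi => geom_sum_of_pow_eq_one (hz i hi), ← sum_filter,
    sum_const, nsmul_eq_mul, mul_comm]

theorem card_eq_of_pow_sums_eq_zero {ι : Type*} [DecidableEq ι] (S : Finset ι) (z : ι → ℂ) {n : ℕ}
    (hn : 0 < n) (hz : ∀ i ∈ S, z i ^ n = 1)
    (h : ∀ j, 0 < j → j < n → ∑ i ∈ S, z i ^ j = 0) :
    n * #{i ∈ S | z i = 1} = #S := by
  have h1 := sum_pow_sums_eq_card S z hz
  rw [sum_eq_single_of_mem 0 (mem_range.2 hn)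
    (fun j hj hj0 => h j (Nat.pos_of_ne_zero hj0) (mem_range.1 hj))] at h1
  simp only [pow_zero, sum_const, nsmul_eq_mul, mul_one] at h1
  exact_mod_cast h1.symm

theorem apply_pow_eq_one {n : ℕ} (hexp : ∀ x : G, n • x = 0) (χ : AddChar G ℂ) (x : G) :
    χ x ^ n = 1 := by
  rw [← AddChar.map_nsmul_eq_pow, hexp, AddChar.map_zero_eq_one]

/-- The sum is an integer polynomial evaluated at a primitive root `ζ`; the minimal polynomial of
`ζ` divides it and also kills the conjugate `ζ ^ j`. -/
theorem charSum_pow_eq_zero {n : ℕ} (hn : 0 < n) (hexp : ∀ x : G, n • x = 0) (A : Finset G)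
    (χ : AddChar G ℂ) (h : charSum A χ = 0) {j : ℕ} (hj : j.Coprime n) :
    charSum A (χ ^ j) = 0 := by
  have hζ := Complex.isPrimitiveRoot_exp n hn.ne'
  set ζ := Complex.exp (2 * Real.pi * Complex.I / n)
  have hn' : NeZero n := ⟨hn.ne'⟩
  choose e _ he using fun a => hζ.eq_pow_of_pow_eq_one (apply_pow_eq_one hexp χ a)
  let P : Polynomial ℤ := ∑ a ∈ A, Polynomial.X ^ e a
  have hP : Polynomial.aeval ζ P = 0 := by
    simpa [P, he, charSum] using h
  have hd : minpoly ℤ ζ ∣ P := minpoly.isIntegrallyClosed_dvd (hζ.isIntegral hn) hP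
  rw [hζ.minpoly_eq_pow_coprime hj] at hd
  have h2 : Polynomial.aeval (ζ ^ j) P = 0 := by
    obtain ⟨Q, hQ⟩ := hd
    rw [hQ, map_mul, minpoly.aeval, zero_mul]
  simp only [P, map_sum, map_pow, Polynomial.aeval_X] at h2
  rw [charSum, ← h2]
  refine sum_congr rfl fun a _ => ?_
  rw [AddChar.pow_apply, ← he, ← pow_mul, ← pow_mul, mul_comm]

theorem charSum_sub (A : Finset G) (χ : AddChar G ℂ) (g : G) :
    ∑ a ∈ A, χ (a - g) = charSum A χ * χ (-g) := by
  simp_rw [sub_eq_add_neg, AddChar.map_add_eq_mul, charSum, sum_mul]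

theorem card_le_of_inf_charKer_eq_bot {n : ℕ} (hn : 0 < n) (N : AddSubgroup G) (χ : AddChar G ℂ)
    (hχ : ∀ x ∈ N, χ x ^ n = 1) (h : N ⊓ charKer χ = ⊥) : Nat.card N ≤ n := by
  have hinj : Function.Injective
      (fun x : N => (⟨χ x, (Polynomial.mem_nthRootsFinset hn 1).2 (hχ x x.2)⟩ :
        Polynomial.nthRootsFinset n (1 : ℂ))) := by
    intro x y hxy
    have hxy' : χ x = χ y := congrArg Subtype.val hxy
    have : (x - y : G) ∈ N ⊓ charKer χ := by
      refine ⟨N.sub_mem x.2 y.2, mem_charKer.2 ?_⟩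
      rw [AddChar.map_sub_eq_div, hxy', div_self fun h0 => by
        simpa [h0] using AddChar.map_add_eq_mul χ y (-y)]
    rw [h, AddSubgroup.mem_bot, sub_eq_zero] at this
    exact Subtype.ext this
  calc Nat.card N ≤ Nat.card (Polynomial.nthRootsFinset n (1 : ℂ)) :=
        Nat.card_le_card_of_injective _ hinj
    _ = #(Polynomial.nthRootsFinset n (1 : ℂ)) := by simp
    _ ≤ n := by
      classical
      rw [Polynomial.nthRootsFinset]
      exact (Multiset.toFinset_card_le _).trans (Polynomial.card_nthRoots n 1)

theorem multiples_le_charKer_iff {n : ℕ} {η : AddChar G ℂ} :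
    multiples G n ≤ charKer η ↔ η ^ n = 1 := by
  constructor
  · intro h
    ext x
    rw [AddChar.pow_apply, ← AddChar.map_nsmul_eq_pow, AddChar.one_apply]
    exact h (mem_multiples.2 ⟨x, rfl⟩)
  · rintro h _ ⟨x, rfl⟩
    rw [mem_charKer, nsmulAddMonoidHom_apply, AddChar.map_nsmul_eq_pow, ← AddChar.pow_apply, h,
      AddChar.one_apply]

variable [Fintype G]

theorem charSum_mul_charSum_eq_zero {A B : Finset G} (h : IsTilingPair (A : Set G) (B : Set G))
    {χ : AddChar G ℂ} (hχ : χ ≠ 1) : charSum A χ * charSum B χ = 0 := by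
  have h0 : ∑ g, χ g = 0 := AddChar.sum_eq_zero_of_ne_one hχ
  rw [← h0, charSum, charSum, sum_mul_sum, ← sum_product']
  refine sum_bij (fun x _ => x.1 + x.2) (fun _ _ => mem_univ _) ?_ ?_ ?_
  · intro x hx y hy hxy
    exact h.injOn (by simpa using hx) (by simpa using hy) hxy
  · intro g _
    obtain ⟨x, hx, hxg⟩ := h.surjOn (Set.mem_univ g)
    exact ⟨x, by simpa using hx, hxg⟩
  · intro x _
    rw [AddChar.map_add_eq_mul]

-- Fourier inversion: only characters trivial on `H` contribute to the indicator of `A`, so it is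
-- `H`-invariant.
open Classical in
theorem add_mem_of_charSum_eq_zero {A : Finset G} {H : AddSubgroup G}
    (h : ∀ χ : AddChar G ℂ, ¬ H ≤ charKer χ → charSum A χ = 0) {x y : G} (hx : x ∈ H)
    (hy : y ∈ A) : x + y ∈ A := by
  have key (g : G) : ∑ χ : AddChar G ℂ, charSum A χ * χ (-g)
      = if g ∈ A then (Fintype.card G : ℂ) else 0 := by
    simp_rw [← charSum_sub]
    rw [sum_comm]
    simp_rw [AddChar.sum_apply_eq_ite, sub_eq_zero]
    rw [sum_ite_eq' A g]
  have h1 := key (x + y)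
  have h2 : ∑ χ : AddChar G ℂ, charSum A χ * χ (-(x + y))
      = ∑ χ : AddChar G ℂ, charSum A χ * χ (-y) := by
    refine sum_congr rfl fun χ _ => ?_
    by_cases hc : H ≤ charKer χ
    · rw [neg_add, AddChar.map_add_eq_mul, mem_charKer.1 (hc (H.neg_mem hx)), one_mul]
    · rw [h χ hc, zero_mul, zero_mul]
  rw [h2, key y, if_pos hy] at h1
  by_contra hc
  rw [if_neg hc] at h1
  exact Fintype.card_ne_zero (α := G) (by exact_mod_cast h1)

-- Averaging over the characters of `G ⧸ N` isolates a single coset of `N`.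
open Classical in
theorem sum_slice_eq_zero {B : Finset G} {χ : AddChar G ℂ} {N : AddSubgroup G}
    (h : ∀ η : AddChar G ℂ, N ≤ charKer η → charSum B (χ * η) = 0) (g : G) :
    ∑ b ∈ B with b - g ∈ N, χ b = 0 := by
  have h0 : ∑ η : AddChar (G ⧸ N) ℂ, ∑ b ∈ B, χ b * η ((b - g : G) : G ⧸ N) = 0 := by
    refine sum_eq_zero fun η _ => ?_
    have := h (η.compAddMonoidHom (QuotientAddGroup.mk' N)) (fun x hx => by
      rw [mem_charKer, AddChar.compAddMonoidHom_apply, QuotientAddGroup.mk'_apply,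
        (QuotientAddGroup.eq_zero_iff x).2 hx, AddChar.map_zero_eq_one])
    calc _ = charSum B (χ * η.compAddMonoidHom (QuotientAddGroup.mk' N)) *
          η (-(g : G ⧸ N)) := by
          rw [charSum, sum_mul]
          refine sum_congr rfl fun b _ => ?_
          rw [QuotientAddGroup.mk_sub, sub_eq_add_neg, AddChar.map_add_eq_mul, AddChar.mul_apply,
            AddChar.compAddMonoidHom_apply, QuotientAddGroup.mk'_apply, mul_assoc]
      _ = 0 := by rw [this, zero_mul]
  rw [sum_comm] at h0
  simp_rw [← mul_sum, AddChar.sum_apply_eq_ite, QuotientAddGroup.eq_zero_iff, mul_ite, mul_zero]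
    at h0
  rw [← sum_filter, ← sum_mul] at h0
  exact (mul_eq_zero.1 h0).resolve_right (by exact_mod_cast Fintype.card_ne_zero)

-- On `multiples G n` the values of `χ` are `n`-th roots of unity; the vanishing of their power sums
-- over a slice makes them equidistributed.
open Classical in
theorem card_slice_eq {n : ℕ} (hn : 0 < n) (hexp : ∀ x : G, n ^ 2 • x = 0) {B : Finset G}
    {χ : AddChar G ℂ}
    (h : ∀ j, 0 < j → j < n → ∀ η : AddChar G ℂ, η ^ n = 1 → charSum B (χ ^ j * η) = 0) (x : G) :
    n * #{b ∈ B | b - x ∈ multiples G n ⊓ charKer χ} = #{b ∈ B | b - x ∈ multiples G n} := by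
  rw [← card_eq_of_pow_sums_eq_zero {b ∈ B | b - x ∈ multiples G n} (fun b => χ (b - x)) hn,
    filter_filter]
  · simp only [AddSubgroup.mem_inf, mem_charKer]
  · intro b hb
    obtain ⟨y, hy⟩ := mem_multiples.1 (mem_filter.1 hb).2
    rw [← hy, ← AddChar.map_nsmul_eq_pow, ← mul_nsmul, ← sq, hexp, AddChar.map_zero_eq_one]
  · intro j h0 hj
    have := sum_slice_eq_zero (N := multiples G n)
      (fun η hη => h j h0 hj η (multiples_le_charKer_iff.1 hη)) x
    rw [← zero_mul ((χ ^ j) (-x)), ← this, sum_mul]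
    refine sum_congr rfl fun b _ => ?_
    rw [← AddChar.pow_apply, sub_eq_add_neg, AddChar.map_add_eq_mul]

end Characters

/-! ### Periodicity and the construction of new tilings. -/

section Tilings

variable {G : Type*} [AddCommGroup G]

theorem IsTilingPair.symm {A B : Set G} (h : IsTilingPair A B) : IsTilingPair B A := by
  refine ⟨fun _ _ => Set.mem_univ _, ?_, ?_⟩
  · intro x hx y hy hxy
    have := h.injOn (x₁ := x.swap) (x₂ := y.swap) ⟨hx.2, hx.1⟩ ⟨hy.2, hy.1⟩
      (by simpa [add_comm] using hxy)
    exact Prod.swap_injective this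
  · intro g hg
    obtain ⟨x, hx, hxg⟩ := h.surjOn hg
    exact ⟨x.swap, ⟨hx.2, hx.1⟩, by simpa [add_comm] using hxg⟩

theorem isTilingPair_of_existsUnique {A B : Set G}
    (hex : ∀ g, ∃ a ∈ A, ∃ b ∈ B, a + b = g)
    (huniq : ∀ a ∈ A, ∀ a' ∈ A, ∀ b ∈ B, ∀ b' ∈ B, a + b = a' + b' → b = b') :
    IsTilingPair A B := by
  refine ⟨fun _ _ => Set.mem_univ _, ?_, ?_⟩
  · rintro ⟨a, b⟩ ⟨ha, hb⟩ ⟨a', b'⟩ ⟨ha', hb'⟩ h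
    have hb := huniq a ha a' ha' b hb b' hb' h
    subst hb
    exact Prod.ext (add_right_cancel h) rfl
  · intro g _
    obtain ⟨a, ha, b, hb, h⟩ := hex g
    exact ⟨(a, b), ⟨ha, hb⟩, h⟩

theorem IsTilingPair.card_mul_card [Fintype G] {A B : Finset G}
    (h : IsTilingPair (A : Set G) (B : Set G)) : #A * #B = Fintype.card G := by
  classical
  rw [← card_product, ← card_univ]
  refine card_bij (fun x _ => x.1 + x.2) (fun _ _ => mem_univ _) ?_ ?_
  · intro x hx y hy hxy
    exact h.injOn (by simpa using hx) (by simpa using hy) hxy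
  · intro g _
    obtain ⟨x, hx, hxg⟩ := h.surjOn (Set.mem_univ g)
    exact ⟨x, by simpa using hx, hxg⟩

theorem isPeriodicSet_of_add_mem {A : Set G} {H : AddSubgroup G} (hH : H ≠ ⊥)
    (h : ∀ x ∈ H, ∀ a ∈ A, x + a ∈ A) : IsPeriodicSet A := by
  have hout (a : G) : a - (a : G ⧸ H).out ∈ H := by
    rw [← QuotientAddGroup.eq_iff_sub_mem, QuotientAddGroup.out_eq']
  refine ⟨H, {a ∈ A | (a : G ⧸ H).out = a}, hH, ?_, ?_, ?_⟩
  · rintro ⟨x, a⟩ ⟨hx, ha, -⟩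
    exact h x hx a ha
  · rintro ⟨x, a⟩ ⟨hx, -, ha⟩ ⟨y, b⟩ ⟨hy, -, hb⟩ hxy
    simp only at hxy hx hy ha hb
    have hab : a = b := by
      rw [← ha, ← hb]
      congr 1
      rw [QuotientAddGroup.eq_iff_sub_mem]
      have : a - b = y - x := by rw [sub_eq_sub_iff_add_eq_add, add_comm, hxy, add_comm]
      rw [this]
      exact H.sub_mem hy hx
    subst hab
    exact Prod.ext (add_right_cancel hxy) rfl
  · intro a ha
    refine ⟨(a - (a : G ⧸ H).out, (a : G ⧸ H).out), ⟨hout a, ?_, ?_⟩, by simp⟩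
    · have := h _ (H.neg_mem (hout a)) a ha
      rwa [neg_sub, sub_add_cancel] at this
    · simp

/-- A transversal of a coset of `N` modulo `K ≤ N` tiles with a `K`-periodic set. -/
theorem exists_periodic_complement {A : Set G} {K N : AddSubgroup G} (hK : K ≠ ⊥) (hKN : K ≤ N)
    {c : G} (hA : ∀ a ∈ A, a - c ∈ N) (h : ∀ x, x - c ∈ N → ∃! a, a ∈ A ∧ a - x ∈ K) :
    ∃ B' : Set G, IsPeriodicSet B' ∧ IsTilingPair A B' := by
  have hout (a : G) : a - (a : G ⧸ N).out ∈ N := by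
    rw [← QuotientAddGroup.eq_iff_sub_mem, QuotientAddGroup.out_eq']
  -- This set meets each coset of `N` in exactly one coset of `K`.
  refine ⟨{g | g - (g : G ⧸ N).out ∈ K}, isPeriodicSet_of_add_mem hK ?_,
    (isTilingPair_of_existsUnique ?_ ?_).symm⟩
  · intro x hx g hg
    have : ((x + g : G) : G ⧸ N) = g := by
      rw [QuotientAddGroup.eq_iff_sub_mem, add_sub_cancel_right]
      exact hKN hx
    rw [Set.mem_ofPred_eq, this, add_sub_assoc]
    exact K.add_mem hx hg
  · intro g
    obtain ⟨a, ⟨ha, hak⟩, -⟩ := h (g - ((g - c : G) : G ⧸ N).out) (by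
      have := hout (g - c)
      rwa [sub_right_comm] at this)
    refine ⟨g - a, ?_, a, ha, sub_add_cancel g a⟩
    have : ((g - a : G) : G ⧸ N) = (g - c : G) := by
      rw [QuotientAddGroup.eq_iff_sub_mem]
      have := N.neg_mem (hA a ha)
      rwa [show g - a - (g - c) = -(a - c) by abel]
    rw [Set.mem_ofPred_eq, this]
    rw [← neg_mem_iff]
    convert hak using 1
    abel
  · intro b hb b' hb' a ha a' ha' hab
    have hbb : (b : G ⧸ N) = b' := by
      rw [QuotientAddGroup.eq_iff_sub_mem]
      have := N.sub_mem (hA a' ha') (hA a ha)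
      rwa [show a' - c - (a - c) = b - b' by
        rw [sub_sub_sub_cancel_right, sub_eq_sub_iff_add_eq_add, add_comm, ← hab, add_comm]]
        at this
    have hk : a - a' ∈ K := by
      have := K.sub_mem hb' hb
      rw [hbb] at this
      rwa [sub_sub_sub_cancel_right, show b' - b = a - a' by
        rw [sub_eq_sub_iff_add_eq_add, add_comm, add_comm a, hab, add_comm]] at this
    exact (h a' (hA a' ha')).unique ⟨ha, hk⟩ ⟨ha', by simp⟩

open Classical in
/-- Replacing the slices of `A` modulo `N` by cosets of `H ≤ N` keeps the tiling property if the
nonempty slices of `B` are transversals modulo `H`. -/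
theorem exists_periodic_of_slices {A B : Finset G} {n : ℕ} {H N : AddSubgroup G} [Finite N]
    (hAB : IsTilingPair (A : Set G) (B : Set G)) (hHN : H ≤ N) (hN : Nat.card N ≤ n ^ 2)
    (hH : n ^ 2 ≤ Nat.card N → H ≠ ⊥)
    (hA : ∀ a ∈ A, #{x ∈ A | x - a ∈ N} = n) (hB : ∀ b ∈ B, #{x ∈ B | x - b ∈ N} = n)
    (hBH : ∀ b ∈ B, ∀ x, x - b ∈ N → ∃! y, y ∈ B ∧ y - x ∈ H) :
    ∃ A' : Set G, IsPeriodicSet A' ∧ IsTilingPair A' (B : Set G) := by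
  -- Two slices have `n * n` distinct sums in one coset of `N`, which has at most `n ^ 2` elements;
  -- hence they fill it.
  have hfill (a : G) (ha : a ∈ A) (b : G) (hb : b ∈ B) : n ^ 2 ≤ Nat.card N ∧
      ∀ g, g - (a + b) ∈ N → ∃ x ∈ A, ∃ y ∈ B, x - a ∈ N ∧ y - b ∈ N ∧ x + y = g := by
    have := Fintype.ofFinite N
    let S := {x ∈ A | x - a ∈ N} ×ˢ {x ∈ B | x - b ∈ N}
    let T : Finset G := univ.image fun z : N => (z : G) + (a + b)
    have hmaps : Set.MapsTo (fun x : G × G => x.1 + x.2) S T := by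
      rintro ⟨x, y⟩ hxy
      simp only [S, coe_product, coe_filter, Set.mem_prod, Set.mem_ofPred_eq] at hxy
      simp only [T, coe_image, coe_univ, Set.image_univ, Set.mem_range]
      refine ⟨⟨_, N.add_mem hxy.1.2 hxy.2.2⟩, ?_⟩
      simp only
      abel
    have hinj : Set.InjOn (fun x : G × G => x.1 + x.2) S := by
      refine hAB.injOn.mono ?_
      rintro ⟨x, y⟩ hxy
      simp only [S, coe_product, coe_filter, Set.mem_prod, Set.mem_ofPred_eq] at hxy
      exact ⟨hxy.1.1, hxy.2.1⟩
    have hS : #S = n ^ 2 := by rw [card_product, hA a ha, hB b hb, sq]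
    have hT : #T = Nat.card N := by
      rw [card_image_of_injective _ (fun x y h => Subtype.ext (add_right_cancel h)), card_univ,
        Nat.card_eq_fintype_card]
    refine ⟨?_, ?_⟩
    · rw [← hS, ← hT]
      exact card_le_card_of_injOn _ hmaps hinj
    · intro g hg
      have hsurj := surjOn_of_injOn_of_card_le _ hmaps hinj (by rw [hS, hT]; exact hN)
      obtain ⟨⟨x, y⟩, hxy, hg⟩ := hsurj (a := g) (by
        simp only [T, coe_image, coe_univ, Set.image_univ, Set.mem_range]
        exact ⟨⟨_, hg⟩, by simp⟩)
      simp only [S, coe_product, coe_filter, Set.mem_prod, Set.mem_ofPred_eq] at hxy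
      exact ⟨x, hxy.1.1, y, hxy.2.1, hxy.1.2, hxy.2.2, hg⟩
  obtain ⟨⟨a₀, b₀⟩, ⟨ha₀, hb₀⟩, -⟩ := hAB.surjOn (Set.mem_univ 0)
  -- The default `0` is harmless even if `0 ∈ A`: for `g` in a coset `c` missing `A`, `g - 0 ∈ H ≤
  -- N` would put `0` in `c`.
  have hrep (c : G ⧸ N) : ∃ r : G, ∀ a ∈ A, (a : G ⧸ N) = c → r ∈ A ∧ (r : G ⧸ N) = c := by
    by_cases hc : ∃ a ∈ A, (a : G ⧸ N) = c
    · obtain ⟨a, ha⟩ := hc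
      exact ⟨a, fun _ _ _ => ha⟩
    · exact ⟨0, fun a ha hac => (hc ⟨a, ha, hac⟩).elim⟩
  choose r hr using hrep
  refine ⟨{g | r g ∈ A ∧ g - r g ∈ H},
    isPeriodicSet_of_add_mem (hH (hfill a₀ ha₀ b₀ hb₀).1) ?_, isTilingPair_of_existsUnique ?_ ?_⟩
  · intro x hx g hg
    have : ((x + g : G) : G ⧸ N) = g := by
      rw [QuotientAddGroup.eq_iff_sub_mem, add_sub_cancel_right]
      exact hHN hx
    rw [Set.mem_ofPred_eq, this, add_sub_assoc]
    exact ⟨hg.1, H.add_mem hx hg.2⟩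
  · intro g
    obtain ⟨⟨a, b⟩, ⟨ha, hb⟩, hg⟩ := hAB.surjOn (Set.mem_univ g)
    simp only at ha hb hg
    obtain ⟨hra, hra'⟩ := hr a a ha rfl
    have h1 : g - r a - b ∈ N := by
      rw [← hg, show a + b - r a - b = a - r a by abel, ← QuotientAddGroup.eq_iff_sub_mem, hra']
    obtain ⟨y, ⟨hy, hyH⟩, -⟩ := hBH b hb _ h1
    refine ⟨g - y, ?_, y, hy, sub_add_cancel g y⟩
    have h2 : g - y - r a ∈ H := by
      rw [← neg_mem_iff]
      convert hyH using 1
      abel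
    have : ((g - y : G) : G ⧸ N) = a := by
      rw [← hra', QuotientAddGroup.eq_iff_sub_mem]
      exact hHN h2
    rw [Set.mem_ofPred_eq, this]
    exact ⟨hra, h2⟩
  · intro a ha a' ha' b hb b' hb' hab
    -- The slices through `r a` and `b` already represent `r a' + b'`; uniqueness in the original
    -- tiling then puts `a` and `a'` in the same coset of `N`.
    obtain ⟨x, hx, y, hy, hxa, hyb, hxy⟩ := (hfill _ ha.1 b hb).2 (r a' + b') (by
      have := N.sub_mem (hHN ha.2) (hHN ha'.2)
      rwa [show a - r a - (a' - r a') = r a' + b' - (r a + b) by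
        rw [show r a' + b' - (r a + b) = (a' + b') - (a' - r a') - (r a + b) by abel, ← hab]
        abel] at this)
    have := hAB.injOn (x₁ := (x, y)) (x₂ := (r a', b')) ⟨hx, hy⟩ ⟨ha'.1, hb'⟩ hxy
    obtain rfl : x = r a' := congrArg Prod.fst this
    obtain rfl : y = b' := congrArg Prod.snd this
    have h1 : (r a : G ⧸ N) = a := ((QuotientAddGroup.eq_iff_sub_mem).2 (hHN ha.2)).symm
    have h1' : (r a' : G ⧸ N) = a' := ((QuotientAddGroup.eq_iff_sub_mem).2 (hHN ha'.2)).symm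
    have h2 : (a' : G ⧸ N) = a := by
      rw [← h1, ← h1', QuotientAddGroup.eq_iff_sub_mem]
      exact hxa
    have h3 : b - y ∈ H := by
      have := H.sub_mem ha'.2 ha.2
      rw [h2] at this
      rwa [sub_sub_sub_cancel_right, show a' - a = b - y by
        rw [sub_eq_sub_iff_add_eq_add, ← hab, add_comm]] at this
    exact (hBH y hy y (by simp)).unique ⟨hb, h3⟩ ⟨hy, by simp⟩

end Tilings

/-! ### Groups of exponent dividing `p ^ 2` and order `p ^ 4`. -/

section PrimeSquareExponent

variable {G : Type*} [AddCommGroup G]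

open Classical in
theorem card_charKer_coset_eq {A : Finset G} {χ : AddChar G ℂ} {k : ℕ} (hk : 0 < k)
    (hχ : ∀ x, χ x ^ k = 1) (h : ∀ j, 0 < j → j < k → charSum A (χ ^ j) = 0) (g : G) :
    k * #{a ∈ A | a - g ∈ charKer χ} = #A := by
  rw [← card_eq_of_pow_sums_eq_zero A (fun a => χ (a - g)) hk (fun a _ => hχ _)]
  · simp only [mem_charKer]
  · intro j h0 hj
    simp_rw [← AddChar.pow_apply]
    rw [charSum_sub, h j h0 hj, zero_mul]

theorem existsUnique_of_card_filter_eq_one {α : Type*} {A : Finset α} {P : α → Prop}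
    [DecidablePred P] (h : #{a ∈ A | P a} = 1) : ∃! a, a ∈ A ∧ P a := by
  obtain ⟨a, ha⟩ := card_eq_one.1 h
  have h' (x : α) : x ∈ A ∧ P x ↔ x = a := by rw [← mem_filter, ha, mem_singleton]
  exact ⟨a, (h' a).2 rfl, fun y hy => (h' y).1 hy⟩

open Classical in
theorem exists_periodic_complement_of_card_charKer_coset {A : Finset G} {χ : AddChar G ℂ}
    (hK : charKer χ ≠ ⊥) (h : ∀ g, #{a ∈ A | a - g ∈ charKer χ} = 1) :
    ∃ B' : Set G, IsPeriodicSet B' ∧ IsTilingPair (A : Set G) B' :=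
  exists_periodic_complement (N := ⊤) (c := 0) hK le_top (fun _ _ => trivial)
    fun x _ => existsUnique_of_card_filter_eq_one (h x)

variable {p : ℕ}

theorem charKer_ne_bot [Fintype G] (hp : p.Prime)
    (hexp : ∀ x : G, p ^ 2 • x = 0)
    (hcard : Fintype.card G = p ^ 4) (χ : AddChar G ℂ) : charKer χ ≠ ⊥ := by
  intro h
  have := card_le_of_inf_charKer_eq_bot (pow_pos hp.pos 2) ⊤ χ
    (fun x _ => apply_pow_eq_one hexp χ x) (by rw [h, inf_bot_eq])
  rw [AddSubgroup.card_top, Nat.card_eq_fintype_card, hcard] at this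
  exact absurd ((Nat.pow_le_pow_iff_right hp.one_lt).1 this) (by norm_num)

theorem charSum_pow_eq_zero_of_not_dvd (hp : p.Prime) (hexp : ∀ x : G, p ^ 2 • x = 0)
    {A : Finset G} {χ : AddChar G ℂ} (h : charSum A χ = 0) {j : ℕ} (hj : ¬ p ∣ j) :
    charSum A (χ ^ j) = 0 :=
  charSum_pow_eq_zero (pow_pos hp.pos 2) hexp A χ h
    (((hp.coprime_iff_not_dvd.2 hj).symm).pow_right 2)

open Classical in
/-- If `A` is annihilated by a character `χ`, then on each coset of the kernel of `χ ^ p` it is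
equidistributed among the cosets of the kernel of `χ`. -/
theorem card_charKer_pow_coset_eq (hp : p.Prime) (hexp : ∀ x : G, p ^ 2 • x = 0)
    {A : Finset G} {χ : AddChar G ℂ} (h : charSum A χ = 0) (g : G) :
    p * #{a ∈ A | a - g ∈ charKer χ} = #{a ∈ A | a - g ∈ charKer (χ ^ p)} := by
  have h1 := sum_pow_sums_eq_card A (fun a => χ (a - g)) (n := p ^ 2)
    (fun a _ => apply_pow_eq_one hexp χ _)
  have h2 := sum_pow_sums_eq_card A (fun a => (χ ^ p) (a - g)) (n := p) (fun a _ => by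
    rw [AddChar.pow_apply, ← pow_mul, ← sq, apply_pow_eq_one hexp χ])
  have h3 : (range (p ^ 2)).filter (p ∣ ·) = (range p).image (p * ·) := by
    ext j
    simp only [mem_filter, mem_range, mem_image]
    constructor
    · rintro ⟨hj, i, rfl⟩
      exact ⟨i, by rw [sq] at hj; exact lt_of_mul_lt_mul_left' hj, rfl⟩
    · rintro ⟨i, hi, rfl⟩
      exact ⟨by rw [sq]; exact Nat.mul_lt_mul_of_pos_left hi hp.pos, dvd_mul_right _ _⟩
  -- Exponents prime to `p` contribute zero by Galois conjugation; the multiples of `p` give the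
  -- same count for `χ ^ p`.
  rw [← sum_filter_add_sum_filter_not _ (p ∣ ·), h3,
    sum_image (fun a _ b _ hab => Nat.eq_of_mul_eq_mul_left hp.pos hab),
    sum_eq_zero (s := (range (p ^ 2)).filter (¬ p ∣ ·)), add_zero] at h1
  · simp_rw [pow_mul, ← AddChar.pow_apply χ p] at h1
    rw [h2] at h1
    have hp0 : (p : ℂ) ≠ 0 := by exact_mod_cast hp.ne_zero
    push_cast at h1
    rw [sq, mul_assoc] at h1
    have h4 := mul_left_cancel₀ hp0 h1
    simp only [mem_charKer]
    exact_mod_cast h4.symm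
  · intro j hj
    simp_rw [← AddChar.pow_apply]
    rw [charSum_sub, charSum_pow_eq_zero_of_not_dvd hp hexp h (mem_filter.1 hj).2, zero_mul]

theorem exists_periodic_complement_of_card_le [Fintype G] (hp : p.Prime)
    (hexp : ∀ x : G, p ^ 2 • x = 0)
    (hcard : Fintype.card G = p ^ 4) {A : Finset G} (hA : #A ≤ p) (hA0 : A.Nonempty)
    {χ : AddChar G ℂ} (h : charSum A χ = 0) :
    ∃ B' : Set G, IsPeriodicSet B' ∧ IsTilingPair (A : Set G) B' := by
  classical
  obtain ⟨c, hc⟩ := hA0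
  have key := card_charKer_pow_coset_eq hp hexp h
  have hle (g : G) : #{a ∈ A | a - g ∈ charKer (χ ^ p)} ≤ p := (card_filter_le _ _).trans hA
  have hc1 : 0 < #{a ∈ A | a - c ∈ charKer χ} :=
    card_pos.2 ⟨c, mem_filter.2 ⟨hc, by simp⟩⟩
  have hcp : p ≤ #{a ∈ A | a - c ∈ charKer (χ ^ p)} := by
    rw [← key]
    exact Nat.le_mul_of_pos_right p hc1
  have hall : {a ∈ A | a - c ∈ charKer (χ ^ p)} = A :=
    eq_of_subset_of_card_le (filter_subset _ _) (hA.trans hcp)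
  have hAc : ∀ a ∈ A, a - c ∈ charKer (χ ^ p) := fun a ha =>
    (mem_filter.1 (hall.symm ▸ ha : a ∈ {a ∈ A | a - c ∈ charKer (χ ^ p)})).2
  refine exists_periodic_complement (K := charKer χ) (N := charKer (χ ^ p)) (c := c)
    (charKer_ne_bot hp hexp hcard χ) ?_ hAc ?_
  · intro x hx
    rw [mem_charKer] at hx ⊢
    rw [AddChar.pow_apply, hx, one_pow]
  · intro x hx
    refine existsUnique_of_card_filter_eq_one (Nat.eq_of_mul_eq_mul_left hp.pos ?_)
    rw [key, mul_one, filter_true_of_mem, ← hall]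
    · exact le_antisymm (hle c) hcp
    · intro a ha
      have := (charKer (χ ^ p)).sub_mem (hAc a ha) hx
      rwa [sub_sub_sub_cancel_right] at this

theorem exists_periodic_complement_of_charSum_pow [Fintype G] (hp : p.Prime)
    (hexp : ∀ x : G, p ^ 2 • x = 0) (hcard : Fintype.card G = p ^ 4) {A : Finset G}
    (hA : #A = p ^ 2) {χ : AddChar G ℂ} (h : charSum A χ = 0) (h' : charSum A (χ ^ p) = 0) :
    ∃ B' : Set G, IsPeriodicSet B' ∧ IsTilingPair (A : Set G) B' := by
  classical
  have hp2 := pow_pos hp.pos 2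
  refine exists_periodic_complement_of_card_charKer_coset (charKer_ne_bot hp hexp hcard χ)
    fun g => Nat.eq_of_mul_eq_mul_left hp2 ?_
  rw [card_charKer_coset_eq hp2 (apply_pow_eq_one hexp χ) _ g, hA, mul_one]
  intro j h0 hj
  by_cases hpj : p ∣ j
  · obtain ⟨i, rfl⟩ := hpj
    rw [pow_mul]
    refine charSum_pow_eq_zero_of_not_dvd hp hexp h' fun hi => ?_
    have := Nat.le_of_dvd h0 (mul_dvd_mul_left p hi)
    rw [sq] at hj
    omega
  · exact charSum_pow_eq_zero_of_not_dvd hp hexp h hpj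

theorem isPeriodicSet_of_charSum_eq_zero [Fintype G] {A : Finset G} (hN : multiples G p ≠ ⊥)
    (h : ∀ χ : AddChar G ℂ, χ ^ p ≠ 1 → charSum A χ = 0) : IsPeriodicSet (A : Set G) :=
  isPeriodicSet_of_add_mem hN fun _ hx _ ha => add_mem_of_charSum_eq_zero
    (fun χ hχ => h χ (mt multiples_le_charKer_iff.2 hχ)) hx ha

-- The zero at `ψ` puts `p` elements in each coset of `charKer ψ`, which contains `multiples G p`,
-- so a slice has at most `p`; by `hslice` a nonempty one has at least `p`.
open Classical in
theorem card_slice_eq_prime (hp : p.Prime) (hexp : ∀ x : G, p ^ 2 • x = 0) {A : Finset G}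
    (hA : #A = p ^ 2) {χ ψ : AddChar G ℂ} (hψ : ψ ^ p = 1) (h : charSum A ψ = 0)
    (hslice : ∀ x, p * #{a ∈ A | a - x ∈ multiples G p ⊓ charKer χ}
      = #{a ∈ A | a - x ∈ multiples G p}) {x : G} (hx : x ∈ A) :
    #{a ∈ A | a - x ∈ multiples G p} = p := by
  have h1 : p * #{a ∈ A | a - x ∈ charKer ψ} = #A :=
    card_charKer_coset_eq hp.pos (fun y => by rw [← AddChar.pow_apply, hψ, AddChar.one_apply])
      (fun j h0 hj => charSum_pow_eq_zero_of_not_dvd hp hexp h (Nat.not_dvd_of_pos_of_lt h0 hj)) x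
  rw [hA, sq] at h1
  have h2 := Nat.eq_of_mul_eq_mul_left hp.pos h1
  refine le_antisymm ?_ ?_
  · refine le_trans ?_ h2.le
    exact card_le_card (monotone_filter_right _ fun a _ ha => multiples_le_charKer_iff.2 hψ ha)
  · rw [← hslice]
    exact Nat.le_mul_of_pos_right p (card_pos.2 ⟨x, mem_filter.2 ⟨hx, by simp⟩⟩)

/-- If `χ` of order `p ^ 2` does not annihilate `B`, then `χ ^ p` does, and all characters of the
form `χ ^ j * η` with `0 < j < p` and `η ^ p = 1` annihilate `A`. -/
theorem charSum_pow_mul_eq_zero (hp : p.Prime) (hexp : ∀ x : G, p ^ 2 • x = 0) {A B : Finset G}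
    (hprod : ∀ χ : AddChar G ℂ, χ ≠ 1 → charSum A χ * charSum B χ = 0)
    (hA : ∀ χ : AddChar G ℂ, χ ^ p ≠ 1 → charSum A χ = 0 → charSum A (χ ^ p) ≠ 0)
    (hB : ∀ χ : AddChar G ℂ, χ ^ p ≠ 1 → charSum B χ = 0 → charSum B (χ ^ p) ≠ 0)
    {χ : AddChar G ℂ} (hχ : χ ^ p ≠ 1) (hχB : charSum B χ ≠ 0) :
    charSum B (χ ^ p) = 0 ∧ ∀ j, 0 < j → j < p → ∀ η : AddChar G ℂ, η ^ p = 1 →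
      charSum A (χ ^ j * η) = 0 := by
  have hχ1 : χ ≠ 1 := by rintro rfl; exact hχ (one_pow p)
  have hχA : charSum A χ = 0 := (mul_eq_zero.1 (hprod χ hχ1)).resolve_right hχB
  have hχB' : charSum B (χ ^ p) = 0 := (mul_eq_zero.1 (hprod _ hχ)).resolve_left (hA χ hχ hχA)
  refine ⟨hχB', fun j h0 hj η hη => ?_⟩
  have hpj : ¬ p ∣ j := Nat.not_dvd_of_pos_of_lt h0 hj
  have he : (χ ^ j * η) ^ p = (χ ^ p) ^ j := by
    rw [mul_pow, hη, mul_one, ← pow_mul, ← pow_mul, mul_comm]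
  have hz : charSum B ((χ ^ j * η) ^ p) = 0 := by
    rw [he]
    exact charSum_pow_eq_zero_of_not_dvd hp hexp hχB' hpj
  have hne : (χ ^ j * η) ^ p ≠ 1 := by
    rw [he]
    intro h1
    refine hχ ?_
    have h2 : (χ ^ p) ^ p = 1 := by
      ext x
      rw [← pow_mul, ← sq, AddChar.pow_apply, apply_pow_eq_one hexp, AddChar.one_apply]
    have := pow_gcd_eq_one.2 ⟨h1, h2⟩
    rwa [((hp.coprime_iff_not_dvd.2 hpj).symm), pow_one] at this
  have hne1 : χ ^ j * η ≠ 1 := fun h1 => hne (by rw [h1, one_pow])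
  exact (mul_eq_zero.1 (hprod _ hne1)).resolve_right fun h => hB _ hne h hz

theorem exists_periodic_replacement_of_card_eq [Fintype G] (hp : p.Prime)
    (hexp : ∀ x : G, p ^ 2 • x = 0)
    (hcard : Fintype.card G = p ^ 4) (hN0 : multiples G p ≠ ⊥)
    (hN : Nat.card (multiples G p) ≤ p ^ 2) {A B : Finset G}
    (hAB : IsTilingPair (A : Set G) (B : Set G)) (hAp : ¬ IsPeriodicSet (A : Set G))
    (hBp : ¬ IsPeriodicSet (B : Set G)) (hcA : #A = p ^ 2) (hcB : #B = p ^ 2) :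
    (∃ A' : Set G, IsPeriodicSet A' ∧ IsTilingPair A' (B : Set G)) ∨
    (∃ B' : Set G, IsPeriodicSet B' ∧ IsTilingPair (A : Set G) B') := by
  classical
  by_cases hA : ∃ χ : AddChar G ℂ, charSum A χ = 0 ∧ charSum A (χ ^ p) = 0
  · obtain ⟨χ, h, h'⟩ := hA
    exact Or.inr (exists_periodic_complement_of_charSum_pow hp hexp hcard hcA h h')
  by_cases hB : ∃ χ : AddChar G ℂ, charSum B χ = 0 ∧ charSum B (χ ^ p) = 0
  · obtain ⟨χ, h, h'⟩ := hB
    obtain ⟨A', hA', ht⟩ := exists_periodic_complement_of_charSum_pow hp hexp hcard hcB h h'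
    exact Or.inl ⟨A', hA', ht.symm⟩
  replace hA : ∀ χ : AddChar G ℂ, χ ^ p ≠ 1 → charSum A χ = 0 → charSum A (χ ^ p) ≠ 0 :=
    fun χ _ h h' => hA ⟨χ, h, h'⟩
  replace hB : ∀ χ : AddChar G ℂ, χ ^ p ≠ 1 → charSum B χ = 0 → charSum B (χ ^ p) ≠ 0 :=
    fun χ _ h h' => hB ⟨χ, h, h'⟩
  have hχ : ∃ χ : AddChar G ℂ, χ ^ p ≠ 1 ∧ charSum A χ ≠ 0 := by
    by_contra! h
    exact hAp (isPeriodicSet_of_charSum_eq_zero hN0 h)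
  have hχ' : ∃ χ : AddChar G ℂ, χ ^ p ≠ 1 ∧ charSum B χ ≠ 0 := by
    by_contra! h
    exact hBp (isPeriodicSet_of_charSum_eq_zero hN0 h)
  obtain ⟨χ, hχ, hχA⟩ := hχ
  obtain ⟨χ', hχ', hχB⟩ := hχ'
  obtain ⟨hψA, hBχ⟩ := charSum_pow_mul_eq_zero hp hexp
    (fun χ h => charSum_mul_charSum_eq_zero hAB.symm h) hB hA hχ hχA
  obtain ⟨hψB, hAχ⟩ := charSum_pow_mul_eq_zero hp hexp
    (fun χ h => charSum_mul_charSum_eq_zero hAB h) hA hB hχ' hχB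
  have hpow (χ : AddChar G ℂ) : (χ ^ p) ^ p = 1 := by
    ext x
    rw [← pow_mul, ← sq, AddChar.pow_apply, apply_pow_eq_one hexp, AddChar.one_apply]
  have hsB := card_slice_eq hp.pos hexp hBχ
  have hB1 : ∀ b ∈ B, #{x ∈ B | x - b ∈ multiples G p} = p := fun b hb =>
    card_slice_eq_prime hp hexp hcB (hpow χ') hψB hsB hb
  refine Or.inl (exists_periodic_of_slices (n := p) (H := multiples G p ⊓ charKer χ)
    (N := multiples G p) hAB inf_le_left hN ?_ (fun a ha => card_slice_eq_prime hp hexp hcA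
      (hpow χ) hψA (card_slice_eq hp.pos hexp hAχ) ha) hB1 ?_)
  -- On `multiples G p`, `χ` takes at most `p` values, so a trivial intersection would give `p ^ 2 ≤
  -- p`.
  · intro h hbot
    have hle := card_le_of_inf_charKer_eq_bot hp.pos (multiples G p) χ (by
      rintro _ ⟨x, rfl⟩
      rw [← AddChar.map_nsmul_eq_pow, nsmulAddMonoidHom_apply, ← mul_nsmul, ← sq, hexp,
        AddChar.map_zero_eq_one]) hbot
    have := h.trans hle
    have := hp.one_lt
    nlinarith
  · intro b hb x hx
    refine existsUnique_of_card_filter_eq_one (Nat.eq_of_mul_eq_mul_left hp.pos ?_)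
    rw [hsB, mul_one]
    conv_rhs => rw [← hB1 b hb]
    congr 1
    refine filter_congr fun y _ => ⟨fun hy => ?_, fun hy => ?_⟩
    · simpa using (multiples G p).add_mem hy hx
    · simpa using (multiples G p).sub_mem hy hx

theorem exists_periodic_replacement_of_card_le [Fintype G] (hp : p.Prime)
    (hexp : ∀ x : G, p ^ 2 • x = 0)
    (hcard : Fintype.card G = p ^ 4) (hN0 : multiples G p ≠ ⊥) {A B : Finset G}
    (hAB : IsTilingPair (A : Set G) (B : Set G)) (hBp : ¬ IsPeriodicSet (B : Set G))
    (hA : #A ≤ p) : ∃ B' : Set G, IsPeriodicSet B' ∧ IsTilingPair (A : Set G) B' := by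
  obtain ⟨x, hx, -⟩ := hAB.surjOn (Set.mem_univ 0)
  by_cases h : ∃ χ : AddChar G ℂ, charSum A χ = 0
  · obtain ⟨χ, hχ⟩ := h
    exact exists_periodic_complement_of_card_le hp hexp hcard hA ⟨x.1, hx.1⟩ hχ
  · push Not at h
    refine (hBp (isPeriodicSet_of_charSum_eq_zero hN0 fun χ hχ => ?_)).elim
    exact (mul_eq_zero.1 (charSum_mul_charSum_eq_zero hAB
      (by rintro rfl; exact hχ (one_pow p)))).resolve_left (h χ)

theorem exists_periodic_replacement [Fintype G] (hp : p.Prime)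
    (hexp : ∀ x : G, p ^ 2 • x = 0)
    (hcard : Fintype.card G = p ^ 4) (hN0 : multiples G p ≠ ⊥)
    (hN : Nat.card (multiples G p) ≤ p ^ 2) {A B : Finset G}
    (hAB : IsTilingPair (A : Set G) (B : Set G)) (hAp : ¬ IsPeriodicSet (A : Set G))
    (hBp : ¬ IsPeriodicSet (B : Set G)) :
    (∃ A' : Set G, IsPeriodicSet A' ∧ IsTilingPair A' (B : Set G)) ∨
    (∃ B' : Set G, IsPeriodicSet B' ∧ IsTilingPair (A : Set G) B') := by
  have hprod := hAB.card_mul_card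
  rw [hcard] at hprod
  obtain ⟨i, -, hi⟩ := (Nat.dvd_prime_pow hp).1 ⟨_, hprod.symm⟩
  obtain ⟨k, -, hk⟩ := (Nat.dvd_prime_pow hp).1 ⟨_, (mul_comm #A #B ▸ hprod).symm⟩
  have hik : i + k = 4 := by
    rw [hi, hk, ← pow_add] at hprod
    exact Nat.pow_right_injective hp.two_le hprod
  have hle (m : ℕ) (hm : m ≤ 1) : p ^ m ≤ p :=
    (Nat.pow_le_pow_right hp.pos hm).trans_eq (pow_one p)
  obtain h | h | h : i ≤ 1 ∨ k ≤ 1 ∨ i = 2 ∧ k = 2 := by omega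
  · exact Or.inr (exists_periodic_replacement_of_card_le hp hexp hcard hN0 hAB hBp
      (hi.trans_le (hle i h)))
  · obtain ⟨A', hA', ht⟩ := exists_periodic_replacement_of_card_le hp hexp hcard hN0 hAB.symm hAp
      (hk.trans_le (hle k h))
    exact Or.inl ⟨A', hA', ht.symm⟩
  · exact exists_periodic_replacement_of_card_eq hp hexp hcard hN0 hN hAB hAp hBp
      (by rw [hi, h.1]) (by rw [hk, h.2])

end PrimeSquareExponent

/-! ### The group `ZMod (p ^ 2) × ZMod (p ^ 2)`. -/

theorem card_multiples_le {p : ℕ} (hp : p.Prime) :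
    Nat.card (multiples (ZMod (p ^ 2) × ZMod (p ^ 2)) p) ≤ p ^ 2 := by
  -- Modulo `p ^ 2`, `p • x` depends only on `x` modulo `p`.
  have hz (x : ZMod (p ^ 2)) : ∃ i : Fin p, p • x = ((p * i : ℕ) : ZMod (p ^ 2)) := by
    have : NeZero (p ^ 2) := ⟨(pow_pos hp.pos 2).ne'⟩
    refine ⟨⟨x.val % p, Nat.mod_lt _ hp.pos⟩, ?_⟩
    rw [nsmul_eq_mul]
    conv_lhs => rw [← ZMod.natCast_zmod_val x, ← Nat.cast_mul]
    rw [ZMod.natCast_eq_natCast_iff]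
    have := (Nat.mod_modEq x.val p).symm.mul_left' p
    rwa [← sq] at this
  choose i hi using hz
  have hf : ∀ z : multiples (ZMod (p ^ 2) × ZMod (p ^ 2)) p, ∃ y : Fin p × Fin p,
      (z : ZMod (p ^ 2) × ZMod (p ^ 2)) =
        (((p * y.1 : ℕ) : ZMod (p ^ 2)), ((p * y.2 : ℕ) : ZMod (p ^ 2))) := by
    rintro ⟨_, x, rfl⟩
    exact ⟨(i x.1, i x.2), Prod.ext (hi x.1) (hi x.2)⟩
  choose f hf using hf
  have hinj : Function.Injective f := fun z w h => Subtype.ext (by rw [hf z, hf w, h])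
  calc _ ≤ Nat.card (Fin p × Fin p) := Nat.card_le_card_of_injective f hinj
    _ = p ^ 2 := by simp [sq]

theorem mainTheorem5 (p : ℕ) (hp : p.Prime) (A B : Set (ZMod (p ^ 2) × ZMod (p ^ 2)))
    (hAB : IsTilingPair A B) (hA : ¬ IsPeriodicSet A) (hB : ¬ IsPeriodicSet B) :
    (∃ A' : Set (ZMod (p ^ 2) × ZMod (p ^ 2)), IsPeriodicSet A' ∧ IsTilingPair A' B) ∨
    (∃ B' : Set (ZMod (p ^ 2) × ZMod (p ^ 2)), IsPeriodicSet B' ∧ IsTilingPair A B') := by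
  classical
  have : NeZero (p ^ 2) := ⟨(pow_pos hp.pos 2).ne'⟩
  obtain ⟨A, rfl⟩ := A.toFinite.exists_finset_coe
  obtain ⟨B, rfl⟩ := B.toFinite.exists_finset_coe
  refine exists_periodic_replacement hp (fun x => ?_) ?_ (fun h => ?_) (card_multiples_le hp)
    hAB hA hB
  · have hz (y : ZMod (p ^ 2)) : p ^ 2 • y = 0 := by
      rw [nsmul_eq_mul, ZMod.natCast_self, zero_mul]
    exact Prod.ext (hz x.1) (hz x.2)
  · rw [Fintype.card_prod, ZMod.card, ← pow_add]
  · have h1 : p • ((1, 0) : ZMod (p ^ 2) × ZMod (p ^ 2)) ∈ multiples _ p := ⟨_, rfl⟩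
    rw [h, AddSubgroup.mem_bot] at h1
    have h2 : ((p : ℕ) : ZMod (p ^ 2)) = 0 := by simpa using congrArg Prod.fst h1
    rw [ZMod.natCast_eq_zero_iff] at h2
    have := Nat.le_of_dvd hp.pos h2
    have := hp.one_lt
    nlinarith
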